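/- On-line list coloring. Let $G$ be a finite simple graph and $f:V(G)\to\mathbb{Z}$. In the on-line $f$-list coloring game on $G$ all vertices are initially uncolored. In the $i$th round Alice marks a nonempty set $V_i$ of uncolored vertices (each vertex of $V_i$ receives color $i$ as a permissible color), and Bob then chooses an independent set $X_i\subseteq V_i$ and colors all its vertices with color $i$. Alice wins if at the beginning of the game or at the end of some round there is an uncolored vertex $v$ that has been marked at least $f(v)$ times; otherwise Bob wins. The graph $G$ is on-line $k$-choosable if Bob has a winning strategy for the constant function $f\equiv k$; the on-line choice number $\chi_p(G)$ is the least $k$ such that $G$ is on-line $k$-choosable, and $G$ is on-line chromatic-choosable if $\chi_p(G)=\chi(G)$, where $\chi(G)$ is the chromatic number. The join $G+H$ is the disjoint union of $G$ and $H$ together with all edges $uv$ with $u\in V(G)$, $v\in V(H)$. Corollary. Let $G$ be a finite simple graph with independence number at most $m$, and let there be given a proper coloring of $G$ with $\chi(G)$ colors that has exactly $k_i$ color classes of cardinality $i$ for each $i\ge 1$. If $t\ge 0$ is an integer with $$t\ \ge\ \sum_{p=2}^m\left(\frac{p^2}{2}-\frac{3p}{2}+1\right)k_p-k_1,$$ then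 the join $G+K_t$ is on-line chromatic-choosable. -/

import Mathlib

namespace OnlineListColoring

/-- The join `G + H`: the disjoint union of `G` and `H` together with all edges between them. -/
def join {V W : Type*} (G : SimpleGraph V) (H : SimpleGraph W) : SimpleGraph (V ⊕ W) :=
  (G ⊕g H) ⊔ completeBipartiteGraph V W

/-- A (deterministic) strategy of Bob. The history of the game is the list of the sets that Alice
has marked so far, the most recent set first; Bob answers the history `U :: h` with the set
`σ (U :: h)` of vertices that he colors in the current round. (The value at `[]` is never used.)
His own earlier answers are determined by the strategy and the history. -/
abbrev BobStrategy (V : Type*) := List (Set V) → Set V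

/-- The set of vertices that Bob, playing `σ`, has colored after the rounds in the history. -/
def colored {V : Type*} (σ : BobStrategy V) : List (Set V) → Set V
  | [] => ∅
  | U :: h => colored σ h ∪ σ (U :: h)

open Classical in
/-- The number of rounds of the history in which the vertex `v` has been marked, that is, the
number of permissible colors that have been assigned to `v`. -/
noncomputable def timesMarked {V : Type*} (h : List (Set V)) (v : V) : ℕ :=
  h.countP (fun U => decide (v ∈ U))

/-- Alice has followed the rules against `σ`: in every round she marked a nonempty set of vertices
that were uncolored at that time. -/
def LegalHistory {V : Type*} (σ : BobStrategy V) : List (Set V) → Prop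
  | [] => True
  | U :: h => LegalHistory σ h ∧ U.Nonempty ∧ Disjoint U (colored σ h)

/-- `σ` is a winning strategy of Bob in the on-line `f`-list coloring game on `G`: however Alice
plays, Bob's answers are independent subsets of the marked sets, and at no time (neither at the
beginning of the game nor at the end of a round) is there an uncolored vertex `v` that has used up
its `f v` permissible colors. -/
structure IsWinningStrategy {V : Type*} (G : SimpleGraph V) (f : V → ℤ) (σ : BobStrategy V) :
    Prop where
  subset : ∀ U h, LegalHistory σ (U :: h) → σ (U :: h) ⊆ U
  indep : ∀ U h, LegalHistory σ (U :: h) → G.IsIndepSet (σ (U :: h))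
  safe : ∀ h, LegalHistory σ h → ∀ v, v ∉ colored σ h → (timesMarked h v : ℤ) < f v

/-- `G` is on-line `f`-choosable: Bob has a winning strategy. -/
def OnlineFChoosable {V : Type*} (G : SimpleGraph V) (f : V → ℤ) : Prop :=
  ∃ σ : BobStrategy V, IsWinningStrategy G f σ

/-- `G` is on-line `k`-choosable. -/
def OnlineChoosable {V : Type*} (G : SimpleGraph V) (k : ℕ) : Prop :=
  OnlineFChoosable G (fun _ => (k : ℤ))

/-- The on-line choice number: the least `k` such that `G` is on-line `k`-choosable
(and `⊤` if there is no such `k`). -/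
noncomputable def onlineChoiceNumber {V : Type*} (G : SimpleGraph V) : ℕ∞ :=
  ⨅ (k : ℕ) (_ : OnlineChoosable G k), (k : ℕ∞)

/-- `G` is on-line chromatic-choosable: its on-line choice number equals its chromatic number. -/
def OnlineChromaticChoosable {V : Type*} (G : SimpleGraph V) : Prop :=
  onlineChoiceNumber G = G.chromaticNumber

/-- The number of color classes of cardinality `i` of a coloring. -/
noncomputable def numClasses {V : Type*} {G : SimpleGraph V} {n : ℕ} (C : G.Coloring (Fin n))
    (i : ℕ) : ℕ :=
  {c : Fin n | (C.colorClass c).ncard = i}.ncard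

end OnlineListColoring

/-! Bob keeps the uncolored vertices in an ordered list of single vertices and a family of
independent parts, while `f` counts the marks each vertex has left. A list vertex of level `l`
reserves one mark for itself, one for each list vertex ahead of it and `slope l p` for each part of
size `p`. A set of `s + 1` vertices of one part reserves `potential s` marks in total.

The heart is `Safe.exists_answer`. A fully marked part is colored. Otherwise, if a marked subset `Q`
of a part meets its bound with equality, Bob colors the marked vertices of that part and moves the
others to the list at level `#Q`: comparing `Q` with `insert x Q` shows that each moved `x` has
enough marks left. If no such `Q` exists, every marked subset has slack, and Bob colors either the
first marked list vertex or the marked vertices of the most marked part, according to whether some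
marked list vertex has a level at least the largest number of marks in a part. What the colored
vertices reserved pays for the marks.

Initially `f` is the number `k` of colors and the singleton classes form the list. A part of size
`p` exceeds its share `s + 1` of `(s + 1) * k` by at most `(p - 1).choose 2`, and each singleton
leaves one unit unused; `K_t` supplies `t` further singletons. Conversely, Alice can force a proper
coloring by marking everything. -/

namespace OnlineListColoring

/-! ### Arithmetic of slopes and weights -/

/-- The number of turns that a part with `p` vertices may cost a list vertex of level `l`. -/
def slope (l p : ℕ) : ℕ := max 1 (p - l)

/-- The contribution of a part with `p` vertices to the potential of the sets with `s + 1`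
vertices. -/
def weight (s p : ℕ) : ℕ := 1 + ∑ i ∈ Finset.range s, slope (i + 1) p

lemma one_le_slope (l p : ℕ) : 1 ≤ slope l p := le_max_left _ _

lemma sub_le_slope (l p : ℕ) : p - l ≤ slope l p := le_max_right _ _

lemma weight_zero (p : ℕ) : weight 0 p = 1 := by simp [weight]

lemma weight_succ (s p : ℕ) : weight (s + 1) p = weight s p + slope (s + 1) p := by
  simp [weight, Finset.sum_range_succ, add_assoc]

lemma succ_le_weight (s p : ℕ) : s + 1 ≤ weight s p := by
  induction s with
  | zero => simp [weight_zero]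
  | succ s ih => have := one_le_slope (s + 1) p; rw [weight_succ]; omega

/-- Each of the first `s` slopes is at least `p - s`, hence at least `p - j + 1`. This pays for `p -
j` vertices moved to level `q`, together with a mark on each of `s + 1` vertices. -/
lemma succ_add_mul_le_weight {s q j p : ℕ} (hs : s < q) (hqj : q ≤ j) (hj : j < p) :
    s + 1 + (p - j) * s ≤ weight s p := by
  induction s with
  | zero => simp [weight_zero]
  | succ s ih =>
    have h1 := ih (by omega)
    have h2 := sub_le_slope (s + 1) p
    rw [weight_succ, mul_add, mul_one]
    omega

/-- The slope at level `q` is still at least `p - j` but may lack the extra unit, so only `s` marks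
are paid for; from then on each slope contributes at least one. -/
lemma add_mul_min_le_weight {q j p : ℕ} (s : ℕ) (hq : 1 ≤ q) (hqj : q ≤ j) (hj : j < p) :
    s + (p - j) * min s q ≤ weight s p := by
  rcases lt_or_ge s q with h | h
  · have := succ_add_mul_le_weight h hqj hj
    rw [min_eq_left h.le]; omega
  · rw [min_eq_right h]
    induction s, h using Nat.le_induction with
    | base =>
      obtain ⟨r, rfl⟩ : ∃ r, q = r + 1 := ⟨q - 1, by omega⟩
      have h1 := succ_add_mul_le_weight (s := r) (Nat.lt_succ_self r) hqj hj
      have h2 := sub_le_slope (r + 1) p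
      rw [weight_succ, mul_add, mul_one]
      omega
    | succ s _ ih => have := one_le_slope (s + 1) p; rw [weight_succ]; omega

/-- Slopes up to level `p - 2` are at least 2, later ones at least 1. This pays for moving the last
vertex of a part to the front of the list. -/
lemma min_add_le_weight {p : ℕ} (s : ℕ) (hp : 2 ≤ p) : min s (p - 1) + s ≤ weight s p := by
  have key : ∀ s, s ≤ p - 2 → 1 + 2 * s ≤ weight s p := by
    intro s
    induction s with
    | zero => simp [weight_zero]
    | succ s ih =>
      intro h
      have h1 := ih (by omega)
      have h2 := sub_le_slope (s + 1) p
      rw [weight_succ]; omega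
  rcases le_or_gt s (p - 2) with h | h
  · have := key s h; omega
  · have h : p - 2 ≤ s := h.le
    have : p - 1 + s ≤ weight s p := by
      induction s, h using Nat.le_induction with
      | base => have := key _ le_rfl; omega
      | succ s _ ih =>
        have := one_le_slope (s + 1) p
        rw [weight_succ]
        rcases le_or_gt s (p - 2) with h | h
        · have := key s h; omega
        · have := ih h; omega
    omega

lemma slope_mono (l : ℕ) {p p' : ℕ} (h : p ≤ p') : slope l p ≤ slope l p' := by
  unfold slope; omega

lemma slope_sub_succ_le {l j p : ℕ} (hl : l < j) (hj : j < p) :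
    slope l (p - j) + 1 ≤ slope l p := by
  unfold slope; omega

/-- The whole gain `j` already occurs at level 1, where the slopes are `p - 1` and `p - j - 1`;
monotonicity preserves it. This pays for shrinking a part by `j` vertices. -/
lemma weight_sub_add_min_le {j p : ℕ} (s : ℕ) (hj : j + 2 ≤ p) :
    weight s (p - j) + min s j ≤ weight s p := by
  induction s with
  | zero => simp [weight_zero]
  | succ s ih =>
    have h1 := slope_mono (s + 1) (Nat.sub_le p j)
    rw [weight_succ, weight_succ]
    rcases Nat.eq_zero_or_pos s with rfl | h
    · simp only [weight_zero, slope]; omega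
    · have h2 : ∀ r, 1 ≤ r → weight r (p - j) + j ≤ weight r p := by
        intro r hr
        induction r, hr using Nat.le_induction with
        | base => simp only [weight_succ, weight_zero, slope]; omega
        | succ r _ ih =>
          have h1 := slope_mono (r + 1) (Nat.sub_le p j)
          rw [weight_succ, weight_succ]; omega
      have := h2 s h
      omega

lemma sum_range_tsub_le (a s : ℕ) : ∑ i ∈ Finset.range s, (a - i) ≤ (a + 1).choose 2 := by
  induction a generalizing s with
  | zero => simp
  | succ a ih =>
    cases s with
    | zero => simp
    | succ s =>
      have h : (a + 1 + 1).choose 2 = a + 1 + (a + 1).choose 2 := by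
        rw [Nat.choose_succ_succ' (a + 1) 1, Nat.choose_one_right]
      rw [Finset.sum_range_succ', h]
      have := ih s
      simp only [Nat.add_sub_add_right]
      omega

lemma weight_le (s p : ℕ) : weight s p ≤ s + 1 + (p - 1).choose 2 := by
  have h : ∀ i, slope (i + 1) p = 1 + (p - 2 - i) := fun i => by unfold slope; omega
  have h2 := sum_range_tsub_le (p - 2) s
  simp only [weight, h, Finset.sum_add_distrib, Finset.sum_const, Finset.card_range, smul_eq_mul,
    mul_one]
  rcases le_or_gt p 1 with hp | hp
  · have : p - 2 = 0 := by omega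
    simp [this]
    omega
  · rw [show p - 2 + 1 = p - 1 by omega] at h2
    omega

end OnlineListColoring

/-! ### Positions and the invariant -/

namespace OnlineListColoring

open Finset

/-- Bob's bookkeeping: the uncolored vertices are split into a list of single vertices, ordered by
decreasing level and, within a level, by increasing time, and a family of independent parts. -/
structure Position (V : Type*) where
  list : Finset V
  parts : Finset (Finset V)
  lev : V → ℕ
  time : V → ℤ

namespace Position

variable {V : Type*} (D : Position V)

/-- `y` comes before `x` in the order of the list. -/
abbrev Precedes (y x : V) : Prop :=
  D.lev x < D.lev y ∨ (D.lev y = D.lev x ∧ D.time y < D.time x)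

/-- The number of list vertices before `x`. -/
def rank (x : V) : ℕ := #{y ∈ D.list | D.Precedes y x}

/-- The number of turns that the parts may cost a list vertex of level `l`. -/
def demand (l : ℕ) : ℕ := ∑ P ∈ D.parts, slope l #P

/-- The total of the remaining tolerances that a set of `s + 1` vertices of a part needs. -/
def potential (s : ℕ) : ℕ := ∑ x ∈ D.list, min s (D.lev x) + ∑ P ∈ D.parts, weight s #P

lemma potential_zero : D.potential 0 = #D.parts := by simp [potential, weight_zero]

/-- The increment counts the list vertices of level at least `s + 1` and the demand there: what a
vertex entering at the end of that level must reserve, apart from the vertices moved with it. -/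
lemma potential_succ (s : ℕ) :
    D.potential (s + 1) = D.potential s + #{x ∈ D.list | s + 1 ≤ D.lev x} + D.demand (s + 1) := by
  have h : ∀ x, min (s + 1) (D.lev x) = min s (D.lev x) + if s + 1 ≤ D.lev x then 1 else 0 := by
    intro x; split_ifs <;> omega
  simp only [potential, weight_succ, demand, h, sum_add_distrib, card_filter]
  omega

end Position

variable {V : Type*} [Fintype V] [DecidableEq V]

/-- The invariant that Bob maintains: `W` is the set of uncolored vertices and `f v` is the number
of times that `v` may still be marked. -/
structure Safe (G : SimpleGraph V) (D : Position V) (W : Finset V) (f : V → ℤ) : Prop where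
  mem_iff : ∀ v, v ∈ W ↔ v ∈ D.list ∨ ∃ P ∈ D.parts, v ∈ P
  notMem_list : ∀ P ∈ D.parts, ∀ v ∈ P, v ∉ D.list
  eq_of_mem : ∀ P ∈ D.parts, ∀ Q ∈ D.parts, ∀ v ∈ P, v ∈ Q → P = Q
  two_le_card : ∀ P ∈ D.parts, 2 ≤ #P
  indep : ∀ P ∈ D.parts, G.IsIndepSet (P : Set V)
  time_inj : ∀ x ∈ D.list, ∀ y ∈ D.list, D.time x = D.time y → x = y
  lev_le : ∀ x ∈ D.list, D.lev x ≤ Fintype.card V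
  list_bound : ∀ x ∈ D.list, (D.rank x + D.demand (D.lev x) + 1 : ℤ) ≤ f x
  part_bound : ∀ P ∈ D.parts, ∀ Q ⊆ P, Q.Nonempty → (D.potential (#Q - 1) : ℤ) ≤ ∑ v ∈ Q, f v

/-- The tolerances after the vertices of `U` have been marked. -/
def mark (f : V → ℤ) (U : Finset V) (v : V) : ℤ := f v - if v ∈ U then 1 else 0

omit [Fintype V] in
lemma sum_mark (f : V → ℤ) (U Q : Finset V) : ∑ v ∈ Q, mark f U v = ∑ v ∈ Q, f v - #(Q ∩ U) := by
  simp [mark, sum_sub_distrib, ← filter_mem_eq_inter]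

omit [Fintype V] in
lemma le_mark_of_notMem {f : V → ℤ} {U : Finset V} {v : V} (h : v ∉ U) : mark f U v = f v := by
  simp [mark, h]

/-! ### Moving the rest of a part to the list -/

namespace Safe

variable {G : SimpleGraph V} {D : Position V} {W U P : Finset V} {f : V → ℤ}

omit [DecidableEq V] in
lemma one_le (h : Safe G D W f) {v : V} (hv : v ∈ W) : 1 ≤ f v := by
  rcases (h.mem_iff v).1 hv with hv | ⟨P, hP, hv⟩
  · have := h.list_bound v hv
    omega
  · have := h.part_bound P hP {v} (by simpa using hv) (by simp)
    have hpos : 0 < #D.parts := card_pos.2 ⟨P, hP⟩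
    simp only [card_singleton, Nat.sub_self, D.potential_zero, sum_singleton] at this
    omega

/-- Bob colors the marked vertices of the part `P` and moves its other vertices to the list. -/
lemma moveToList (h : Safe G D W f) (hP : P ∈ D.parts) {l : ℕ} {lev' : V → ℕ} {time' : V → ℤ}
    (hl : l ≤ Fintype.card V)
    (hlev : ∀ x ∈ D.list, lev' x = D.lev x) (htime : ∀ x ∈ D.list, time' x = D.time x)
    (hlevR : ∀ x ∈ P \ U, lev' x = l)
    (hinj : ∀ x ∈ P \ U, ∀ y ∈ D.list ∪ P \ U, time' x = time' y → x = y)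
    -- Deleting `P` lowers the demand on `x` by this slope, which has to cover the newcomers ahead
    -- of `x` and a possible mark.
    (hold : ∀ x ∈ D.list, #{y ∈ P \ U | lev' x < l ∨ (l = lev' x ∧ time' y < time' x)} +
      (if x ∈ U then 1 else 0) ≤ slope (D.lev x) #P)
    (hnew : ∀ x ∈ P \ U, (#{y ∈ D.list ∪ P \ U | lev' x < lev' y ∨ (lev' y = lev' x ∧
      time' y < time' x)} + D.demand l + 1 : ℤ) ≤ f x + slope l #P)
    -- The weight released by `P` and the slack of `Q` have to cover the newcomers' terms in the
    -- potential and the marks in `Q`.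
    (hparts : ∀ P' ∈ D.parts, P' ≠ P → ∀ Q ⊆ P', Q.Nonempty →
      (D.potential (#Q - 1) + #(P \ U) * min (#Q - 1) l + #(Q ∩ U) : ℤ) ≤
        ∑ v ∈ Q, f v + weight (#Q - 1) #P) :
    Safe G ⟨D.list ∪ P \ U, D.parts.erase P, lev', time'⟩ (W \ (P ∩ U)) (mark f U) := by
  have hdisj : Disjoint D.list (P \ U) := by
    rw [disjoint_left]
    intro x hx hx'
    exact h.notMem_list P hP x (mem_sdiff.1 hx').1 hx
  have hdemand : ∀ k, ∑ P' ∈ D.parts.erase P, slope k #P' + slope k #P = D.demand k :=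
    fun k => sum_erase_add _ _ hP
  have hweight : ∀ k, ∑ P' ∈ D.parts.erase P, weight k #P' + weight k #P =
      ∑ P' ∈ D.parts, weight k #P' := fun k => sum_erase_add _ _ hP
  have hpot : ∀ k, (∑ x ∈ D.list ∪ P \ U, min k (lev' x) + ∑ P' ∈ D.parts.erase P, weight k #P') +
      weight k #P = D.potential k + #(P \ U) * min k l := by
    intro k
    rw [sum_union hdisj, sum_congr rfl fun x hx => by rw [hlev x hx],
      sum_congr (s₁ := P \ U) rfl fun x hx => by rw [hlevR x hx], sum_const, smul_eq_mul,
      Position.potential, ← hweight]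
    ring
  refine ⟨?_, ?_, ?_, ?_, ?_, ?_, ?_, ?_, ?_⟩
  · intro v
    simp only [mem_sdiff, mem_union, mem_inter, mem_erase, h.mem_iff]
    constructor
    · rintro ⟨hv | ⟨P', hP', hv⟩, hn⟩
      · exact Or.inl (Or.inl hv)
      · by_cases he : P' = P
        · subst he; tauto
        · exact Or.inr ⟨P', ⟨he, hP'⟩, hv⟩
    · rintro ((hv | hv) | ⟨P', ⟨he, hP'⟩, hv⟩)
      · exact ⟨Or.inl hv, fun hh => h.notMem_list P hP v hh.1 hv⟩
      · exact ⟨Or.inr ⟨P, hP, hv.1⟩, fun hh => hv.2 hh.2⟩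
      · exact ⟨Or.inr ⟨P', hP', hv⟩, fun hh => he (h.eq_of_mem P' hP' P hP v hv hh.1)⟩
  · intro P' hP' v hv
    obtain ⟨he, hP'⟩ := mem_erase.1 hP'
    simp only [mem_union, mem_sdiff, not_or, not_and]
    exact ⟨h.notMem_list P' hP' v hv, fun hh => absurd (h.eq_of_mem P' hP' P hP v hv hh) he⟩
  · intro P' hP' Q hQ
    exact h.eq_of_mem P' (mem_of_mem_erase hP') Q (mem_of_mem_erase hQ)
  · intro P' hP'
    exact h.two_le_card P' (mem_of_mem_erase hP')
  · intro P' hP'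
    exact h.indep P' (mem_of_mem_erase hP')
  · intro x hx y hy hxy
    dsimp only at hx hy hxy
    rcases mem_union.1 hx with hx' | hx'
    · rcases mem_union.1 hy with hy' | hy'
      · rw [htime x hx', htime y hy'] at hxy
        exact h.time_inj x hx' y hy' hxy
      · exact (hinj y hy' x hx hxy.symm).symm
    · exact hinj x hx' y hy hxy
  · intro x hx
    rcases mem_union.1 hx with hx' | hx'
    · exact (hlev x hx').trans_le (h.lev_le x hx')
    · exact (hlevR x hx').trans_le hl
  · intro x hx
    rcases mem_union.1 hx with hx' | hx'
    · have h1 := h.list_bound x hx'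
      have h2 := hold x hx'
      have h3 := hdemand (D.lev x)
      have h4 : Position.rank ⟨D.list ∪ P \ U, D.parts.erase P, lev', time'⟩ x =
          D.rank x + #{y ∈ P \ U | lev' x < l ∨ (l = lev' x ∧ time' y < time' x)} := by
        simp only [Position.rank, Position.Precedes]
        rw [filter_union, card_union_of_disjoint (disjoint_filter_filter hdisj)]
        congr 2
        · refine filter_congr fun y hy => ?_
          rw [hlev y hy, hlev x hx', htime y hy, htime x hx']
        · refine filter_congr fun y hy => ?_
          rw [hlevR y hy]
      simp only [Position.demand] at h1 h3 h4 ⊢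
      rw [hlev x hx', h4]
      unfold mark
      split_ifs at h2 ⊢ <;> omega
    · have h1 := hnew x hx'
      have h3 := hdemand l
      rw [le_mark_of_notMem (mem_sdiff.1 hx').2]
      simp only [Position.demand, Position.rank, Position.Precedes, hlevR x hx'] at h1 h3 ⊢
      omega
  · intro P' hP' Q hQ hne
    obtain ⟨he, hP'⟩ := mem_erase.1 hP'
    have h1 := hparts P' hP' he Q hQ hne
    have h2 := hpot (#Q - 1)
    rw [sum_mark]
    simp only [Position.potential] at h1 h2 ⊢
    push_cast at h1 h2 ⊢
    zify at h2
    linarith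

end Safe

/-- No set of marked vertices of a part satisfies the invariant with equality. -/
def NoTight (D : Position V) (U : Finset V) (f : V → ℤ) : Prop :=
  ∀ P ∈ D.parts, ∀ Q ⊆ P, Q ⊆ U → Q.Nonempty → (D.potential (#Q - 1) + 1 : ℤ) ≤ ∑ v ∈ Q, f v

omit [Fintype V] in
/-- Marking costs a set of `s + 1` vertices at most `s` more than its slack. -/
lemma NoTight.card_inter_le {D : Position V} {U P Q : Finset V} {f : V → ℤ} (h : NoTight D U f)
    (hP : P ∈ D.parts) (hQ : Q ⊆ P) (hne : Q.Nonempty)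
    (hb : (D.potential (#Q - 1) : ℤ) ≤ ∑ v ∈ Q, f v) {k : ℕ}
    (hk : #(P ∩ U) ≤ k) :
    (D.potential (#Q - 1) + #(Q ∩ U) : ℤ) ≤ ∑ v ∈ Q, f v + min (#Q - 1) k := by
  have hc := card_pos.2 hne
  have h1 : #(Q ∩ U) ≤ #(P ∩ U) := card_le_card (inter_subset_inter_right hQ)
  -- A fully marked `Q` has one unit of slack; any other `Q` has an unmarked vertex.
  by_cases hU : Q ⊆ U
  · have := h P hP Q hQ hU hne
    rw [inter_eq_left.2 hU] at h1 ⊢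
    omega
  · have : #(Q ∩ U) < #Q := card_lt_card (Finset.ssubset_iff_subset_ne.2
      ⟨inter_subset_left, fun he => hU (inter_eq_left.1 he)⟩)
    omega

omit [DecidableEq V] in
lemma exists_time_gt (D : Position V) : ∃ T : ℤ, ∀ x, |D.time x| < T :=
  ⟨∑ x, |D.time x| + 1, fun x => Int.lt_add_one_of_le
    (single_le_sum (f := fun x => |D.time x|) (fun _ _ => abs_nonneg _) (mem_univ x))⟩

/-! ### Bob's answers preserve the invariant -/

namespace Safe

variable {G : SimpleGraph V} {D : Position V} {W U P Q : Finset V} {f : V → ℤ}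

/-- The released slope is at least 1 and the released weight at least `s + 1`, so every possible
loss is covered. -/
lemma removePart (h : Safe G D W f) (hP : P ∈ D.parts) (hU : P ⊆ U) :
    ∃ D', Safe G D' (W \ (P ∩ U)) (mark f U) := by
  have hR : P \ U = ∅ := sdiff_eq_empty_iff_subset.2 hU
  refine ⟨_, h.moveToList hP (l := 0) (lev' := D.lev) (time' := D.time) (Nat.zero_le _)
    (fun _ _ => rfl) (fun _ _ => rfl) ?_ ?_ ?_ ?_ ?_⟩
  · simp [hR]
  · simp [hR]
  · intro x _
    have := one_le_slope (D.lev x) #P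
    rw [hR, filter_empty, card_empty]
    split_ifs <;> omega
  · simp [hR]
  · intro P' hP' _ Q hQ hne
    have h1 := h.part_bound P' hP' Q hQ hne
    have h2 := succ_le_weight (#Q - 1) #P
    have h3 : #(Q ∩ U) ≤ #Q := card_le_card inter_subset_left
    have := card_pos.2 hne
    rw [hR, card_empty]
    push_cast
    rw [zero_mul]
    omega

/-- Tightness of `Q` forces large tolerances on the rest of `P`. Its maximal size gives slack to
exactly those marked sets for which the weight of `P` may fall one short. -/
lemma moveEnd (h : Safe G D W f) (hP : P ∈ D.parts) (hPU : ¬ P ⊆ U) (hQP : Q ⊆ P) (hQU : Q ⊆ U)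
    (hQ : Q.Nonempty) (ht : ∑ v ∈ Q, f v ≤ D.potential (#Q - 1))
    (hmax : ∀ P' ∈ D.parts, ∀ Q' ⊆ P', Q' ⊆ U → #Q < #Q' →
      (D.potential (#Q' - 1) + 1 : ℤ) ≤ ∑ v ∈ Q', f v) :
    ∃ D', Safe G D' (W \ (P ∩ U)) (mark f U) := by
  obtain ⟨T, hT⟩ := exists_time_gt D
  have hT' : ∀ x, D.time x < T := fun x => (le_abs_self _).trans_lt (hT x)
  have hdisj : ∀ x ∈ P \ U, x ∉ D.list := fun x hx => h.notMem_list P hP x (mem_sdiff.1 hx).1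
  set e := Fintype.equivFin V
  have hq := card_pos.2 hQ
  have hj : #Q ≤ #(P ∩ U) := card_le_card (subset_inter hQP hQU)
  have hcard : #(P \ U) + #(P ∩ U) = #P := card_sdiff_add_card_inter P U
  have hR : 0 < #(P \ U) := card_pos.2 (sdiff_nonempty.2 hPU)
  have hR' : #(P \ U) = #P - #(P ∩ U) := by omega
  refine ⟨_, h.moveToList hP (l := #Q) (lev' := fun x => if x ∈ P \ U then #Q else D.lev x)
    (time' := fun x => if x ∈ P \ U then T + (e x : ℕ) else D.time x) (card_le_univ _) ?_ ?_ ?_ ?_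
    ?_ ?_ ?_⟩
  · exact fun x hx => if_neg fun hx' => hdisj x hx' hx
  · exact fun x hx => if_neg fun hx' => hdisj x hx' hx
  · exact fun x hx => if_pos hx
  · intro x hx y hy hxy
    simp only [if_pos hx] at hxy
    split_ifs at hxy
    · apply e.injective
      ext
      omega
    · have := hT' y
      omega
  · intro x hx
    have hx' : x ∉ P \ U := fun hx' => hdisj x hx' hx
    simp only [if_neg hx']
    by_cases hl : D.lev x < #Q
    -- Below level `#Q` all newcomers are ahead of `x`; with a mark they cost at most `#P - #(P ∩ U)
    -- + 1 ≤ #P - D.lev x`. At higher levels or at level `#Q` itself none is ahead.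
    · refine (Nat.add_le_add_right (card_filter_le _ _) _).trans ?_
      have h2 := sub_le_slope (D.lev x) #P
      split_ifs <;> omega
    · have h1 : {y ∈ P \ U | D.lev x < #Q ∨ (#Q = D.lev x ∧
          (if y ∈ P \ U then T + (e y : ℕ) else D.time y) < D.time x)} = ∅ := by
        refine filter_eq_empty_iff.2 fun y hy => ?_
        have := hT' x
        rw [if_pos hy]
        omega
      have h2 := one_le_slope (D.lev x) #P
      rw [h1, card_empty]
      split_ifs <;> omega
  · intro x hx
    have hxQ : x ∉ Q := fun hh => (mem_sdiff.1 hx).2 (hQU hh)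
    -- Subtracting the tight bound for `Q` from the bound for `insert x Q` leaves the increment of
    -- the potential as a lower bound for `f x`.
    have h1 := h.part_bound P hP (insert x Q)
      (insert_subset (mem_sdiff.1 hx).1 hQP) (insert_nonempty _ _)
    rw [card_insert_of_notMem hxQ, sum_insert hxQ, Nat.add_sub_cancel] at h1
    have h2 := D.potential_succ (#Q - 1)
    rw [Nat.sub_add_cancel hq] at h2
    have h3 := sub_le_slope #Q #P
    have h4 : #{y ∈ D.list ∪ P \ U |
        (if x ∈ P \ U then #Q else D.lev x) < (if y ∈ P \ U then #Q else D.lev y) ∨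
        ((if y ∈ P \ U then #Q else D.lev y) = (if x ∈ P \ U then #Q else D.lev x) ∧
        (if y ∈ P \ U then T + (e y : ℕ) else D.time y) <
          (if x ∈ P \ U then T + (e x : ℕ) else D.time x))} ≤
        #({y ∈ D.list | #Q ≤ D.lev y} ∪ (P \ U).erase x) := by
      refine card_le_card fun y hy => ?_
      obtain ⟨hy, hy'⟩ := mem_filter.1 hy
      rw [if_pos hx, if_pos hx] at hy'
      by_cases hyR : y ∈ P \ U
      · rw [if_pos hyR, if_pos hyR] at hy'
        refine mem_union_right _ (mem_erase.2 ⟨?_, hyR⟩)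
        rintro rfl
        omega
      · rw [if_neg hyR, if_neg hyR] at hy'
        refine mem_union_left _ (mem_filter.2 ⟨(mem_union.1 hy).resolve_right hyR, ?_⟩)
        omega
    have h5 := card_union_le {y ∈ D.list | #Q ≤ D.lev y} ((P \ U).erase x)
    rw [card_erase_of_mem hx] at h5
    omega
  · intro P' hP' _ Q' hQ' hne
    have h1 := h.part_bound P' hP' Q' hQ' hne
    have hpos := card_pos.2 hne
    have h2 := add_mul_min_le_weight (q := #Q) (j := #(P ∩ U)) (p := #P) (#Q' - 1) hq hj (by omega)
    rw [← hR'] at h2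
    rw [← Nat.cast_mul]
    by_cases hU : Q' ⊆ U
    · rw [inter_eq_left.2 hU]
      by_cases hlt : #Q < #Q'
      · have := hmax P' hP' Q' hQ' hU hlt
        omega
      · have h3 := succ_add_mul_le_weight (s := #Q' - 1) (q := #Q) (j := #(P ∩ U)) (p := #P)
          (by omega) hj (by omega)
        rw [← hR'] at h3
        rw [min_eq_left (by omega)]
        omega
    · have : #(Q' ∩ U) < #Q' := card_lt_card (Finset.ssubset_iff_subset_ne.2
        ⟨inter_subset_left, fun he => hU (inter_eq_left.1 he)⟩)
      omega

/-- At the front of the top level the remaining vertex has rank 0 and every slope is 1, so its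
singleton bound `#D.parts ≤ f z` suffices once `P` is deleted. -/
lemma moveFront (h : Safe G D W f) (hP : P ∈ D.parts) (hR : #(P \ U) = 1)
    (hlist : ∀ x ∈ D.list, x ∈ U → D.lev x < #(P ∩ U))
    (hmax : ∀ P' ∈ D.parts, #(P' ∩ U) ≤ #(P ∩ U)) (hnt : NoTight D U f) :
    ∃ D', Safe G D' (W \ (P ∩ U)) (mark f U) := by
  obtain ⟨T, hT⟩ := exists_time_gt D
  have hT' : ∀ x, -T < D.time x := fun x => (abs_lt.1 (hT x)).1
  have hdisj : ∀ x ∈ P \ U, x ∉ D.list := fun x hx => h.notMem_list P hP x (mem_sdiff.1 hx).1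
  have hcard : #(P \ U) + #(P ∩ U) = #P := card_sdiff_add_card_inter P U
  have hp := h.two_le_card P hP
  obtain ⟨z, hz⟩ := card_eq_one.1 hR
  have hzP : z ∈ P := (mem_sdiff.1 (hz ▸ mem_singleton_self z : z ∈ P \ U)).1
  have hzl : z ∉ D.list := h.notMem_list P hP z hzP
  refine ⟨_, h.moveToList hP (l := Fintype.card V)
    (lev' := fun x => if x = z then Fintype.card V else D.lev x)
    (time' := fun x => if x = z then -T else D.time x) le_rfl ?_ ?_ ?_ ?_ ?_ ?_ ?_⟩
  · exact fun x hx => if_neg fun hx' : x = z => hzl (hx' ▸ hx)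
  · exact fun x hx => if_neg fun hx' : x = z => hzl (hx' ▸ hx)
  · intro x hx
    rw [hz, mem_singleton] at hx
    exact if_pos hx
  · intro x hx y hy hxy
    rw [hz, mem_singleton] at hx
    simp only [if_pos hx] at hxy
    split_ifs at hxy with hyz
    · exact hx.trans hyz.symm
    · have := hT' y
      omega
  · intro x hx
    have h1 : #{y ∈ P \ U | (if x = z then Fintype.card V else D.lev x) < Fintype.card V ∨
        (Fintype.card V = (if x = z then Fintype.card V else D.lev x) ∧
        (if y = z then -T else D.time y) < if x = z then -T else D.time x)} ≤ 1 :=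
      (card_filter_le _ _).trans hR.le
    have h2 := one_le_slope (D.lev x) #P
    have h3 := sub_le_slope (D.lev x) #P
    -- A marked `x` has level below `#P - 1`, so its slope is at least 2: one for the newcomer and
    -- one for the mark.
    by_cases hxU : x ∈ U
    · have := hlist x hx hxU
      rw [if_pos hxU]
      omega
    · rw [if_neg hxU]
      omega
  · intro x hx
    rw [hz, mem_singleton] at hx
    have h1 : {y ∈ D.list ∪ P \ U |
        (if x = z then Fintype.card V else D.lev x) <
          (if y = z then Fintype.card V else D.lev y) ∨
        ((if y = z then Fintype.card V else D.lev y) =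
          (if x = z then Fintype.card V else D.lev x) ∧
        (if y = z then -T else D.time y) < if x = z then -T else D.time x)} = ∅ := by
      refine filter_eq_empty_iff.2 fun y hy => ?_
      rw [if_pos hx, if_pos hx]
      rw [hz] at hy
      by_cases hyz : y = z
      · simp [hyz]
      · simp only [if_neg hyz]
        have h1 := h.lev_le y (by simpa [hyz] using hy)
        have h2 := hT' y
        omega
    have h2 := h.part_bound P hP {x} (by simpa [hx] using hzP) (by simp)
    simp only [card_singleton, Nat.sub_self, D.potential_zero, sum_singleton] at h2
    have h3 : D.demand (Fintype.card V) = #D.parts := by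
      rw [Position.demand, sum_congr rfl (g := fun _ => 1), card_eq_sum_ones]
      intro P' _
      have := card_le_univ P'
      unfold slope
      omega
    have h4 := one_le_slope (Fintype.card V) #P
    rw [h1, h3, card_empty]
    omega
  · intro P' hP' _ Q' hQ' hne
    have h1 := hnt.card_inter_le hP' hQ' hne (h.part_bound P' hP' Q' hQ' hne) (hmax P' hP')
    have h2 := min_add_le_weight (p := #P) (#Q' - 1) hp
    have h3 : #Q' ≤ Fintype.card V := card_le_univ _
    rw [hR, min_eq_left (by omega : #Q' - 1 ≤ Fintype.card V)]
    rw [show #P - 1 = #(P ∩ U) by omega] at h2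
    push_cast
    omega

/-- Bob colors the first marked vertex of the list. -/
lemma removeVertex (h : Safe G D W f) {x : V} (hx : x ∈ D.list)
    (hfirst : ∀ y ∈ D.list, y ∈ U → y ≠ x → D.Precedes x y)
    (hmax : ∀ P ∈ D.parts, #(P ∩ U) ≤ D.lev x) (hnt : NoTight D U f) :
    ∃ D', Safe G D' (W \ {x}) (mark f U) := by
  refine ⟨⟨D.list.erase x, D.parts, D.lev, D.time⟩, ?_, ?_, h.eq_of_mem, h.two_le_card, h.indep,
    ?_, ?_, ?_, ?_⟩
  · intro v
    simp only [mem_sdiff, h.mem_iff, mem_singleton, mem_erase]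
    constructor
    · tauto
    · rintro (hv | ⟨P, hP, hv⟩)
      · tauto
      · exact ⟨Or.inr ⟨P, hP, hv⟩, fun hh => h.notMem_list P hP v hv (hh ▸ hx)⟩
  · exact fun P hP v hv hh => h.notMem_list P hP v hv (mem_of_mem_erase hh)
  · exact fun y hy z hz => h.time_inj y (mem_of_mem_erase hy) z (mem_of_mem_erase hz)
  · exact fun y hy => h.lev_le y (mem_of_mem_erase hy)
  · intro y hy
    obtain ⟨hyx, hy⟩ := mem_erase.1 hy
    have h1 := h.list_bound y hy
    simp only [Position.rank, Position.demand] at h1 ⊢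
    rw [filter_erase]
    by_cases hyU : y ∈ U
    -- A marked `y` comes after `x`, so its drop in rank pays for its mark.
    · have hmem : x ∈ {z ∈ D.list | D.Precedes z y} :=
        mem_filter.2 ⟨hx, hfirst y hy hyU hyx⟩
      have hpos : 0 < #{z ∈ D.list | D.Precedes z y} := card_pos.2 ⟨x, hmem⟩
      have := card_erase_of_mem hmem
      simp only [Position.Precedes] at this hpos h1 ⊢
      simp only [mark, if_pos hyU]
      omega
    · have := card_erase_le (a := x) (s := {z ∈ D.list | D.Precedes z y})
      rw [le_mark_of_notMem hyU]
      simp only [Position.Precedes] at this h1 ⊢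
      omega
  · intro P hP Q hQ hne
    -- Beyond the slack the marks cost at most `min (#Q - 1) (D.lev x)`, exactly the term of `x` in
    -- the potential.
    have h1 := hnt.card_inter_le hP hQ hne (h.part_bound P hP Q hQ hne) (hmax P hP)
    have h2 := sum_erase_add D.list (fun y => min (#Q - 1) (D.lev y)) hx
    rw [sum_mark]
    simp only [Position.potential] at h1 ⊢
    push_cast at h1 ⊢
    zify at h2
    omega

/-- Bob colors the marked vertices of a part of which at least two vertices remain. -/
lemma shrinkPart (h : Safe G D W f) (hP : P ∈ D.parts) (hR : 2 ≤ #(P \ U)) (hPU : 0 < #(P ∩ U))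
    (hlist : ∀ x ∈ D.list, x ∈ U → D.lev x < #(P ∩ U))
    (hmax : ∀ P' ∈ D.parts, #(P' ∩ U) ≤ #(P ∩ U)) (hnt : NoTight D U f) :
    ∃ D', Safe G D' (W \ (P ∩ U)) (mark f U) := by
  have hcard : #(P \ U) + #(P ∩ U) = #P := card_sdiff_add_card_inter P U
  have hR' : #(P \ U) = #P - #(P ∩ U) := by omega
  have hnew : P \ U ∉ D.parts.erase P := by
    intro hmem
    obtain ⟨hne, hmem⟩ := mem_erase.1 hmem
    obtain ⟨v, hv⟩ := card_pos.1 (by omega : 0 < #(P \ U))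
    exact hne (h.eq_of_mem _ hmem P hP v hv (mem_sdiff.1 hv).1)
  have hsum : ∀ F : ℕ → ℕ, ∑ P' ∈ insert (P \ U) (D.parts.erase P), F #P' + F #P =
      ∑ P' ∈ D.parts, F #P' + F #(P \ U) := by
    intro F
    have := sum_erase_add D.parts (fun P' => F #P') hP
    rw [sum_insert hnew]
    omega
  have hsub : ∀ P' ∈ insert (P \ U) (D.parts.erase P), ∃ P'' ∈ D.parts, P' ⊆ P'' ∧
      (P' = P'' ∧ P' ≠ P ∨ P' = P \ U ∧ P'' = P) := by
    intro P' hP'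
    rcases mem_insert.1 hP' with rfl | hP'
    · exact ⟨P, hP, sdiff_subset, Or.inr ⟨rfl, rfl⟩⟩
    · exact ⟨P', mem_of_mem_erase hP', Subset.rfl, Or.inl ⟨rfl, ne_of_mem_erase hP'⟩⟩
  refine ⟨⟨D.list, insert (P \ U) (D.parts.erase P), D.lev, D.time⟩, ?_, ?_, ?_, ?_, ?_,
    h.time_inj, h.lev_le, ?_, ?_⟩
  · intro v
    simp only [mem_sdiff, mem_inter, mem_insert, mem_erase, h.mem_iff, exists_eq_or_imp]
    constructor
    · rintro ⟨hv | ⟨P', hP', hv⟩, hn⟩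
      · exact Or.inl hv
      · by_cases he : P' = P
        · subst he; tauto
        · exact Or.inr (Or.inr ⟨P', ⟨he, hP'⟩, hv⟩)
    · rintro (hv | hv | ⟨P', ⟨he, hP'⟩, hv⟩)
      · exact ⟨Or.inl hv, fun hh => h.notMem_list P hP v hh.1 hv⟩
      · exact ⟨Or.inr ⟨P, hP, hv.1⟩, fun hh => hv.2 hh.2⟩
      · exact ⟨Or.inr ⟨P', hP', hv⟩, fun hh => he (h.eq_of_mem P' hP' P hP v hv hh.1)⟩
  · intro P' hP' v hv
    obtain ⟨P'', hP'', hs, -⟩ := hsub P' hP'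
    exact h.notMem_list P'' hP'' v (hs hv)
  · intro P₁ hP₁ P₂ hP₂ v hv₁ hv₂
    obtain ⟨Q₁, hQ₁, hs₁, ho₁⟩ := hsub P₁ hP₁
    obtain ⟨Q₂, hQ₂, hs₂, ho₂⟩ := hsub P₂ hP₂
    have := h.eq_of_mem Q₁ hQ₁ Q₂ hQ₂ v (hs₁ hv₁) (hs₂ hv₂)
    rcases ho₁ with ⟨h1, h1'⟩ | ⟨h1, h1'⟩ <;> rcases ho₂ with ⟨h2, h2'⟩ | ⟨h2, h2'⟩
    · rw [h1, h2, this]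
    · exact absurd (h1.trans (this.trans h2')) h1'
    · exact absurd (h2.trans (this.symm.trans h1')) h2'
    · rw [h1, h2]
  · intro P' hP'
    rcases mem_insert.1 hP' with rfl | hP'
    · exact hR
    · exact h.two_le_card P' (mem_of_mem_erase hP')
  · intro P' hP'
    obtain ⟨P'', hP'', hs, -⟩ := hsub P' hP'
    exact (h.indep P'' hP'').mono (by exact_mod_cast hs)
  · intro x hx
    have h1 := h.list_bound x hx
    have h2 := hsum (slope (D.lev x))
    have h3 := slope_mono (D.lev x) (Nat.sub_le #P #(P ∩ U))
    rw [← hR'] at h3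
    simp only [Position.rank, Position.demand, Position.Precedes] at h1 ⊢
    by_cases hxU : x ∈ U
    -- Shrinking `P` lowers the slope strictly at levels below `#(P ∩ U)`, which include those of
    -- all marked list vertices.
    · have h4 := slope_sub_succ_le (hlist x hx hxU) (by omega : #(P ∩ U) < #P)
      rw [← hR'] at h4
      simp only [mark, if_pos hxU]
      omega
    · rw [le_mark_of_notMem hxU]
      omega
  · intro P' hP' Q hQ hne
    have h2 := hsum (weight (#Q - 1))
    have h3 := weight_sub_add_min_le (j := #(P ∩ U)) (p := #P) (#Q - 1) (by omega)
    rw [← hR'] at h3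
    obtain ⟨P'', hP'', hs, -⟩ := hsub P' hP'
    have h1 := hnt.card_inter_le hP'' (hQ.trans hs) hne
      (h.part_bound P'' hP'' Q (hQ.trans hs) hne) (hmax P'' hP'')
    rw [sum_mark]
    simp only [Position.potential] at h1 ⊢
    omega

/-- Bob can answer every set of marked vertices so that the invariant is kept. -/
lemma exists_answer (h : Safe G D W f) (hUW : U ⊆ W) (hU : U.Nonempty) :
    ∃ X ⊆ U, G.IsIndepSet (X : Set V) ∧ ∃ D', Safe G D' (W \ X) (mark f U) := by
  have hindep : ∀ P ∈ D.parts, G.IsIndepSet ((P ∩ U : Finset V) : Set V) := fun P hP =>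
    (h.indep P hP).mono (by exact_mod_cast inter_subset_left)
  by_cases hfull : ∃ P ∈ D.parts, P ⊆ U
  · obtain ⟨P, hP, hPU⟩ := hfull
    exact ⟨P ∩ U, inter_subset_right, hindep P hP, h.removePart hP hPU⟩
  push Not at hfull
  by_cases hnt : NoTight D U f
  -- If one marked list vertex has a level this high, so does the first marked one, whose level is
  -- maximal.
  · by_cases hv : ∃ x ∈ D.list ∩ U, ∀ P ∈ D.parts, #(P ∩ U) ≤ D.lev x
    · obtain ⟨x₀, hx₀, hx₀'⟩ := hv
      obtain ⟨x₁, hx₁, hx₁'⟩ := exists_max_image (D.list ∩ U) D.lev ⟨x₀, hx₀⟩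
      obtain ⟨x, hx, hx'⟩ := exists_min_image {x ∈ D.list ∩ U | D.lev x = D.lev x₁} D.time
        ⟨x₁, mem_filter.2 ⟨hx₁, rfl⟩⟩
      obtain ⟨hx, hxl⟩ := mem_filter.1 hx
      obtain ⟨hx, hxU⟩ := mem_inter.1 hx
      refine ⟨{x}, singleton_subset_iff.2 hxU, by simp, h.removeVertex hx ?_ ?_ hnt⟩
      · intro y hy hyU hyx
        have h1 := hx₁' y (mem_inter.2 ⟨hy, hyU⟩)
        rcases h1.lt_or_eq with h1 | h1
        · exact Or.inl (by omega)
        · have h2 := hx' y (mem_filter.2 ⟨mem_inter.2 ⟨hy, hyU⟩, h1⟩)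
          exact Or.inr ⟨by omega, h2.lt_of_ne fun he => hyx (h.time_inj x hx y hy he).symm⟩
      · intro P hP
        have h1 := hx₀' P hP
        have h2 := hx₁' x₀ hx₀
        omega
    · push Not at hv
      have hpart : ∃ P ∈ D.parts, 0 < #(P ∩ U) := by
        obtain ⟨v, hv'⟩ := hU
        rcases (h.mem_iff v).1 (hUW hv') with hl | ⟨P, hP, hvP⟩
        · obtain ⟨P, hP, hlt⟩ := hv v (mem_inter.2 ⟨hl, hv'⟩)
          exact ⟨P, hP, by omega⟩
        · exact ⟨P, hP, card_pos.2 ⟨v, mem_inter.2 ⟨hvP, hv'⟩⟩⟩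
      obtain ⟨P₀, hP₀, hpos⟩ := hpart
      obtain ⟨P, hP, hmax⟩ := exists_max_image D.parts (fun P => #(P ∩ U)) ⟨P₀, hP₀⟩
      have hlist : ∀ x ∈ D.list, x ∈ U → D.lev x < #(P ∩ U) := by
        intro x hx hxU
        obtain ⟨P', hP', hlt⟩ := hv x (mem_inter.2 ⟨hx, hxU⟩)
        exact hlt.trans_le (hmax P' hP')
      have hR : 0 < #(P \ U) := card_pos.2 (sdiff_nonempty.2 (hfull P hP))
      refine ⟨P ∩ U, inter_subset_right, hindep P hP, ?_⟩
      rcases (show #(P \ U) = 1 ∨ 2 ≤ #(P \ U) by omega) with hR | hR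
      · exact h.moveFront hP hR hlist hmax hnt
      · exact h.shrinkPart hP hR (hpos.trans_le (hmax P₀ hP₀)) hlist hmax hnt
  · have hne : {Q : Finset V | (∃ P ∈ D.parts, Q ⊆ P) ∧ Q ⊆ U ∧ Q.Nonempty ∧
        ∑ v ∈ Q, f v ≤ D.potential (#Q - 1)}.Nonempty := by
      unfold NoTight at hnt
      push Not at hnt
      obtain ⟨P, hP, Q, hQP, hQU, hQ, hlt⟩ := hnt
      exact ⟨Q, ⟨P, hP, hQP⟩, hQU, hQ, by omega⟩
    obtain ⟨Q, ⟨⟨P, hP, hQP⟩, hQU, hQ, ht⟩, hmax⟩ :=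
      Set.exists_max_image _ (fun Q : Finset V => #Q) (Set.toFinite _) hne
    refine ⟨P ∩ U, inter_subset_right, hindep P hP,
      h.moveEnd hP (hfull P hP) hQP hQU hQ ht fun P' hP' Q' hQ' hQU' hlt => ?_⟩
    by_contra hc
    have := hmax Q' ⟨⟨P', hP', hQ'⟩, hQU', card_pos.1 (by omega), by omega⟩
    omega

end Safe

end OnlineListColoring

/-! ### From the invariant to a winning strategy -/

namespace OnlineListColoring

open Finset

lemma timesMarked_cons {V : Type*} (U : Set V) (h : List (Set V)) (v : V) [Decidable (v ∈ U)] :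
    timesMarked (U :: h) v = timesMarked h v + if v ∈ U then 1 else 0 := by
  simp [timesMarked, List.countP_cons]

section Strategy

variable {V : Type*} [Fintype V] [DecidableEq V] {G : SimpleGraph V}

/-- An invariant that Bob can maintain and that keeps all tolerances positive yields a winning
strategy. -/
theorem onlineFChoosable_of_invariant (good : Finset V → (V → ℤ) → Prop)
    (hstep : ∀ W f U, good W f → U ⊆ W → U.Nonempty →
      ∃ X ⊆ U, G.IsIndepSet (X : Set V) ∧ good (W \ X) (mark f U))
    (hpos : ∀ W f, good W f → ∀ v ∈ W, 1 ≤ f v) {f : V → ℤ} (hf : good univ f) :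
    OnlineFChoosable G f := by
  classical
  choose! answer hsub hindep hgood using hstep
  -- The state pairs the uncolored set with the remaining tolerances, both recomputed from Alice's
  -- moves.
  let state : List (Set V) → Finset V × (V → ℤ) := fun h =>
    h.foldr (fun U s => (s.1 \ answer s.1 s.2 U.toFinset, mark s.2 U.toFinset)) (univ, f)
  let σ : BobStrategy V := fun h => match h with
    | [] => ∅
    | U :: h => (answer (state h).1 (state h).2 U.toFinset : Set V)
  have hcol : ∀ h v, v ∈ (state h).1 ↔ v ∉ colored σ h := by
    intro h v
    induction h with
    | nil => simp [state, colored]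
    | cons U h ih =>
      have : v ∈ (state (U :: h)).1 ↔ v ∈ (state h).1 ∧
          v ∉ answer (state h).1 (state h).2 U.toFinset := mem_sdiff
      simp [this, ih, colored, σ]
  have htol : ∀ h v, (state h).2 v = f v - timesMarked h v := by
    intro h v
    induction h with
    | nil => simp [state, timesMarked]
    | cons U h ih =>
      have : (state (U :: h)).2 v = (state h).2 v - if v ∈ U.toFinset then 1 else 0 := rfl
      rw [this, ih, timesMarked_cons]
      simp only [Set.mem_toFinset]
      push_cast
      ring
  have hU : ∀ U h, LegalHistory σ (U :: h) → U.toFinset ⊆ (state h).1 ∧ U.toFinset.Nonempty := by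
    rintro U h ⟨-, hne, hd⟩
    refine ⟨fun v hv => (hcol h v).2 (Set.disjoint_left.1 hd (Set.mem_toFinset.1 hv)), ?_⟩
    simpa using hne
  have hinv : ∀ h, LegalHistory σ h → good (state h).1 (state h).2 := by
    intro h
    induction h with
    | nil => exact fun _ => hf
    | cons U h ih =>
      intro hl
      exact hgood _ _ _ (ih hl.1) (hU U h hl).1 (hU U h hl).2
  refine ⟨σ, ⟨?_, ?_, ?_⟩⟩
  · intro U h hl v hv
    exact Set.mem_toFinset.1 (hsub _ _ _ (hinv h hl.1) (hU U h hl).1 (hU U h hl).2 hv)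
  · intro U h hl
    exact hindep _ _ _ (hinv h hl.1) (hU U h hl).1 (hU U h hl).2
  · intro h hl v hv
    have h1 := hpos _ _ (hinv h hl) v ((hcol h v).2 hv)
    rw [htol] at h1
    omega

theorem Safe.onlineFChoosable {D : Position V} {f : V → ℤ} (h : Safe G D univ f) :
    OnlineFChoosable G f := by
  refine onlineFChoosable_of_invariant (fun W f => ∃ D, Safe G D W f) ?_ ?_ ⟨D, h⟩
  · rintro W f U ⟨D, hD⟩ hUW hU
    exact hD.exists_answer hUW hU
  · rintro W f ⟨D, hD⟩ v hv
    exact hD.one_le hv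

/-! ### The initial position -/

omit [DecidableEq V] in
/-- A coloring with sufficiently many classes that are singletons gives on-line choosability with
as many colors. -/
theorem onlineChoosable_of_coloring {κ : Type*} [Fintype κ] [DecidableEq κ] (C : G.Coloring κ)
    (h : ∑ c, (#{v | C v = c} - 1).choose 2 ≤ #{c | #{v | C v = c} = 1}) :
    OnlineChoosable G (Fintype.card κ) := by
  classical
  set cls : κ → Finset V := fun c => {v | C v = c}
  have hmem : ∀ {v c}, v ∈ cls c ↔ C v = c := by simp [cls]
  have hinj : ∀ c ∈ ({c | 2 ≤ #(cls c)} : Finset κ),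
      ∀ c' ∈ ({c | 2 ≤ #(cls c)} : Finset κ), cls c = cls c' → c = c' := by
    intro c hc c' _ he
    rw [mem_filter_univ] at hc
    obtain ⟨v, hv⟩ := card_pos.1 (show 0 < #(cls c) by omega)
    exact (hmem.1 hv).symm.trans (hmem.1 (he ▸ hv))
  set D : Position V :=
    { list := {v | #(cls (C v)) = 1}
      parts := ({c | 2 ≤ #(cls c)} : Finset κ).image cls
      -- At this level every part has slope 1, so the demand is just the number of parts.
      lev := fun _ => Fintype.card V
      time := fun v => (Fintype.equivFin V v : ℕ) }
  have hsum : ∀ F : ℕ → ℕ, ∑ P ∈ D.parts, F #P = ∑ c with 2 ≤ #(cls c), F #(cls c) :=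
    fun F => sum_image hinj
  have hlist : #D.list = #{c | #(cls c) = 1} := by
    rw [card_eq_sum_card_fiberwise (f := C) (t := univ) (by simp), card_filter]
    refine sum_congr rfl fun c _ => ?_
    split_ifs with hc
    · rw [← hc]
      congr 1
      ext v
      simp only [D, mem_filter, mem_univ, true_and, hmem, and_iff_right_iff_imp]
      rintro rfl
      exact hc
    · refine card_eq_zero.2 (filter_eq_empty_iff.2 fun v hv he => hc ?_)
      rw [← he]
      exact (mem_filter_univ v).1 hv
  have hparts : #D.parts = #{c | 2 ≤ #(cls c)} := card_image_of_injOn fun c hc c' hc' => hinj c hc c' hc'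
  have hcard : #D.list + #D.parts ≤ Fintype.card κ := by
    rw [hlist, hparts, ← card_union_of_disjoint]
    · exact card_le_univ _
    · exact disjoint_filter.2 fun c _ h1 h2 => by omega
  have hpot : ∀ s, D.potential s ≤ (s + 1) * Fintype.card κ := by
    intro s
    have h1 : ∑ x ∈ D.list, min s (D.lev x) ≤ #D.list * s :=
      sum_le_card_nsmul _ _ _ fun x _ => min_le_left _ _
    have h2 : ∑ P ∈ D.parts, weight s #P ≤ #D.parts * (s + 1) + #D.list := by
      calc ∑ P ∈ D.parts, weight s #P
          ≤ ∑ P ∈ D.parts, (s + 1 + (#P - 1).choose 2) := sum_le_sum fun P _ => weight_le s #P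
        _ = #D.parts * (s + 1) + ∑ c with 2 ≤ #(cls c), (#(cls c) - 1).choose 2 := by
            rw [sum_add_distrib, sum_const, smul_eq_mul, hsum fun p => (p - 1).choose 2]
        _ ≤ #D.parts * (s + 1) + ∑ c, (#(cls c) - 1).choose 2 :=
            Nat.add_le_add_left (sum_le_sum_of_subset (subset_univ _)) _
        _ ≤ #D.parts * (s + 1) + #D.list := Nat.add_le_add_left (h.trans hlist.ge) _
    -- A singleton contributes at most `s`, not `s + 1`; the spare units absorb the excess of the
    -- parts.
    have h3 := Nat.mul_le_mul_left (s + 1) hcard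
    rw [Position.potential]
    nlinarith
  refine Safe.onlineFChoosable (D := D) ⟨?_, ?_, ?_, ?_, ?_, ?_, ?_, ?_, ?_⟩
  · intro v
    simp only [mem_univ, true_iff]
    have hpos : 0 < #(cls (C v)) := card_pos.2 ⟨v, hmem.2 rfl⟩
    by_cases h1 : #(cls (C v)) = 1
    · exact Or.inl ((mem_filter_univ v).2 h1)
    · exact Or.inr ⟨cls (C v), mem_image_of_mem _ ((mem_filter_univ _).2 (by omega)), hmem.2 rfl⟩
  · intro P hP v hv hl
    obtain ⟨c, hc, rfl⟩ := mem_image.1 hP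
    obtain rfl := hmem.1 hv
    have h1 := (mem_filter_univ _).1 hc
    have h2 : #(cls (C v)) = 1 := (mem_filter_univ v).1 hl
    omega
  · intro P hP Q hQ v hvP hvQ
    obtain ⟨c, hc, rfl⟩ := mem_image.1 hP
    obtain ⟨c', hc', rfl⟩ := mem_image.1 hQ
    rw [← hmem.1 hvP, ← hmem.1 hvQ]
  · intro P hP
    obtain ⟨c, hc, rfl⟩ := mem_image.1 hP
    exact (mem_filter_univ c).1 hc
  · intro P hP u hu v hv _ hadj
    obtain ⟨c, hc, rfl⟩ := mem_image.1 hP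
    exact C.valid hadj ((hmem.1 hu).trans (hmem.1 hv).symm)
  · intro x _ y _ hxy
    apply (Fintype.equivFin V).injective
    ext
    exact Int.ofNat.inj hxy
  · exact fun x _ => le_rfl
  · intro x hx
    have h1 : D.rank x ≤ #(D.list.erase x) := by
      refine card_le_card fun y hy => ?_
      obtain ⟨hy, hy'⟩ := mem_filter.1 hy
      refine mem_erase.2 ⟨?_, hy⟩
      rintro rfl
      omega
    have hpos : 0 < #D.list := card_pos.2 ⟨x, hx⟩
    rw [card_erase_of_mem hx] at h1
    have h2 : D.demand (D.lev x) = #D.parts := by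
      rw [Position.demand, sum_congr rfl (g := fun _ => 1), card_eq_sum_ones]
      intro P _
      have : #P ≤ D.lev x := card_le_univ P
      unfold slope
      omega
    omega
  · intro P hP Q hQ hne
    have h1 := hpot (#Q - 1)
    rw [Nat.sub_add_cancel (card_pos.2 hne)] at h1
    rw [sum_const, nsmul_eq_mul]
    exact_mod_cast h1

end Strategy

/-! ### Lower bounds, joins and the count of color classes -/

/-- If Alice always marks all uncolored vertices, Bob's answers form a proper coloring. -/
theorem OnlineChoosable.colorable {V : Type*} {G : SimpleGraph V} {k : ℕ}
    (h : OnlineChoosable G k) : G.Colorable k := by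
  classical
  obtain ⟨σ, hσ⟩ := h
  have key : ∀ j : ℕ, ∃ h, LegalHistory σ h ∧
      (∃ c : V → ℕ, (∀ v ∈ colored σ h, c v < j) ∧
        ∀ u ∈ colored σ h, ∀ v ∈ colored σ h, G.Adj u v → c u ≠ c v) ∧
      ∀ v ∉ colored σ h, timesMarked h v = j := by
    intro j
    induction j with
    | zero =>
      exact ⟨[], trivial, ⟨fun _ => 0, by simp [colored], by simp [colored]⟩,
        by simp [timesMarked]⟩
    | succ j ih =>
      obtain ⟨h, hl, ⟨c, hc, hadj⟩, hm⟩ := ih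
      by_cases hall : (colored σ h)ᶜ.Nonempty
      · have hl' : LegalHistory σ ((colored σ h)ᶜ :: h) := ⟨hl, hall, disjoint_compl_left⟩
        have hind := hσ.indep _ _ hl'
        refine ⟨_, hl', ⟨fun v => if v ∈ colored σ h then c v else j, ?_, ?_⟩, ?_⟩
        · intro v _
          dsimp only
          split_ifs with hv
          · exact (hc v hv).trans (Nat.lt_succ_self j)
          · exact Nat.lt_succ_self j
        · intro u hu v hv huv
          dsimp only
          split_ifs with hu' hv' hv'
          · exact hadj u hu' v hv' huv
          · exact (hc u hu').ne
          · exact (hc v hv').ne'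
          · exact fun _ => hind (hu.resolve_left hu') (hv.resolve_left hv') huv.ne huv
        · intro v hv
          have hv' : v ∉ colored σ h := fun hh => hv (Or.inl hh)
          rw [timesMarked_cons, hm v hv', if_pos (Set.mem_compl hv')]
      -- With every vertex colored Alice has no legal move; the history stays and the claim on marks
      -- is vacuous.
      · rw [Set.not_nonempty_iff_eq_empty, Set.compl_empty_iff] at hall
        exact ⟨h, hl, ⟨c, fun v hv => (hc v hv).trans (Nat.lt_succ_self j), hadj⟩, by simp [hall]⟩
  obtain ⟨h, hl, ⟨c, hc, hadj⟩, hm⟩ := key k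
  have hall : ∀ v, v ∈ colored σ h := by
    intro v
    by_contra hv
    have h1 := hσ.safe h hl v hv
    have h2 := hm v hv
    omega
  exact ⟨SimpleGraph.Coloring.mk (fun v => ⟨c v, hc v (hall v)⟩)
    fun {u v} huv he => hadj u (hall u) v (hall v) huv (congrArg Fin.val he)⟩

lemma chromaticNumber_le_onlineChoiceNumber {V : Type*} (G : SimpleGraph V) :
    G.chromaticNumber ≤ onlineChoiceNumber G :=
  le_iInf₂ fun _ hk => hk.colorable.chromaticNumber_le

lemma OnlineChoosable.onlineChoiceNumber_le {V : Type*} {G : SimpleGraph V} {k : ℕ}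
    (h : OnlineChoosable G k) : onlineChoiceNumber G ≤ k :=
  iInf₂_le k h

/-- A proper coloring of `G + K_t` uses `t` colors outside of `G`. -/
lemma colorable_sub_of_colorable_join {V : Type*} {G : SimpleGraph V} {t k : ℕ}
    (h : (join G (⊤ : SimpleGraph (Fin t))).Colorable k) : t ≤ k ∧ G.Colorable (k - t) := by
  obtain ⟨C⟩ := h
  have hinj : Function.Injective fun i : Fin t => C (Sum.inr i) := by
    intro i j hij
    by_contra hne
    exact C.valid (show (join G ⊤).Adj (Sum.inr i) (Sum.inr j) by simpa [join] using hne) hij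
  have hcard : #(univ.image fun i : Fin t => C (Sum.inr i)) = t := by
    rw [card_image_of_injective _ hinj, card_fin]
  refine ⟨by simpa [hcard] using card_le_univ (univ.image fun i : Fin t => C (Sum.inr i)), ?_⟩
  have hout : ∀ v : V, C (Sum.inl v) ∉ univ.image fun i : Fin t => C (Sum.inr i) := by
    intro v hv
    obtain ⟨i, -, hi⟩ := mem_image.1 hv
    exact C.valid (show (join G ⊤).Adj (Sum.inr i) (Sum.inl v) by simp [join]) hi
  have C' : G.Coloring {x // x ∉ univ.image fun i : Fin t => C (Sum.inr i)} :=
    SimpleGraph.Coloring.mk (fun v => ⟨C (Sum.inl v), hout v⟩) fun {u v} huv he =>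
      C.valid (show (join G ⊤).Adj (Sum.inl u) (Sum.inl v) by simpa [join] using huv)
        (congrArg Subtype.val he)
  have := C'.colorable
  rwa [Fintype.card_subtype_compl, Fintype.card_fin, Fintype.card_coe, hcard] at this

lemma add_le_chromaticNumber_join {V : Type*} {G : SimpleGraph V} {n : ℕ} (t : ℕ)
    (hn : G.chromaticNumber = n) :
    ((n + t : ℕ) : ℕ∞) ≤ (join G (⊤ : SimpleGraph (Fin t))).chromaticNumber := by
  refine le_iInf₂ fun k hk => ?_
  obtain ⟨htk, hc⟩ := colorable_sub_of_colorable_join hk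
  have h := hc.chromaticNumber_le
  rw [hn] at h
  have h : n ≤ k - t := by exact_mod_cast h
  exact_mod_cast (by omega : n + t ≤ k)

/-- The coloring of `G + K_t` that extends a coloring of `G` by `t` new colors. -/
def joinColoring {V : Type*} {G : SimpleGraph V} {n : ℕ} (C : G.Coloring (Fin n)) (t : ℕ) :
    (join G (⊤ : SimpleGraph (Fin t))).Coloring (Fin n ⊕ Fin t) :=
  SimpleGraph.Coloring.mk (Sum.map C id) fun {u v} huv => by
    rcases u with u | u <;> rcases v with v | v
    · simpa using C.valid (by simpa [join] using huv)
    · simp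
    · simp
    · simpa [join] using huv

@[simp]
lemma joinColoring_inl {V : Type*} {G : SimpleGraph V} {n : ℕ} (C : G.Coloring (Fin n)) (t : ℕ)
    (v : V) : joinColoring C t (Sum.inl v) = Sum.inl (C v) := rfl

@[simp]
lemma joinColoring_inr {V : Type*} {G : SimpleGraph V} {n : ℕ} (C : G.Coloring (Fin n)) (t : ℕ)
    (i : Fin t) : joinColoring C t (Sum.inr i) = Sum.inr i := rfl

lemma numClasses_eq {V : Type*} [Fintype V] {G : SimpleGraph V} {n : ℕ} (C : G.Coloring (Fin n))
    (i : ℕ) : numClasses C i = #{c | #{v | C v = c} = i} := by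
  have h : ∀ c, (C.colorClass c).ncard = #{v | C v = c} := by
    intro c
    rw [← Set.ncard_coe_finset]
    congr 1
    ext v
    simp [SimpleGraph.Coloring.colorClass]
  rw [numClasses, ← Set.ncard_coe_finset]
  simp [h]

/-- The coefficient is `(p - 1).choose 2`, which vanishes for `p ≤ 1`; classes are independent, so
none exceeds `m`. -/
lemma sum_numClasses {V : Type*} [Fintype V] {G : SimpleGraph V} {m n : ℕ} (hm : G.indepNum ≤ m)
    (C : G.Coloring (Fin n)) :
    ∑ p ∈ Finset.Icc 2 m, ((p : ℝ) ^ 2 / 2 - 3 * (p : ℝ) / 2 + 1) * (numClasses C p : ℝ) =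
      ((∑ c, (#{v | C v = c} - 1).choose 2 : ℕ) : ℝ) := by
  have hle : ∀ c, #{v | C v = c} ≤ m := fun c =>
    (SimpleGraph.IsIndepSet.card_le_indepNum fun u hu v hv _ huv => C.valid huv (by
      simp only [coe_filter, mem_univ, true_and, Set.mem_ofPred_eq] at hu hv
      rw [hu, hv])).trans hm
  have h1 : ∑ c, (#{v | C v = c} - 1).choose 2 =
      ∑ c with 2 ≤ #{v | C v = c}, (#{v | C v = c} - 1).choose 2 := by
    refine (sum_filter_of_ne fun c _ hc => ?_).symm
    by_contra hlt
    exact hc (Nat.choose_eq_zero_of_lt (by omega))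
  rw [h1, ← sum_fiberwise_of_maps_to (t := Finset.Icc 2 m) (g := fun c => #{v | C v = c})
    fun c hc => Finset.mem_Icc.2 ⟨(mem_filter_univ c).1 hc, hle c⟩]
  push_cast
  refine sum_congr rfl fun p hp => ?_
  obtain ⟨hp, -⟩ := Finset.mem_Icc.1 hp
  rw [sum_congr rfl (g := fun _ => ((p - 1).choose 2 : ℝ)) fun c hc => by
    rw [(mem_filter.1 hc).2], sum_const, nsmul_eq_mul, numClasses_eq, mul_comm, filter_filter,
    Nat.cast_choose_two, Nat.cast_sub (by omega : 1 ≤ p)]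
  have h2 : #{c | #{v | C v = c} = p} = #{c | 2 ≤ #{v | C v = c} ∧ #{v | C v = c} = p} := by
    congr 1
    ext c
    simp only [mem_filter, mem_univ, true_and]
    omega
  rw [h2]
  push_cast
  ring

end OnlineListColoring

theorem mainTheorem3 {V : Type*} [Finite V] (G : SimpleGraph V) (m : ℕ) (hm : G.indepNum ≤ m)
    (n : ℕ) (hn : G.chromaticNumber = (n : ℕ∞)) (C : G.Coloring (Fin n)) (t : ℕ)
    (ht : (t : ℝ) ≥ (∑ p ∈ Finset.Icc 2 m,
        ((p : ℝ) ^ 2 / 2 - 3 * (p : ℝ) / 2 + 1) * (OnlineListColoring.numClasses C p : ℝ))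
      - (OnlineListColoring.numClasses C 1 : ℝ)) :
    OnlineListColoring.OnlineChromaticChoosable
      (OnlineListColoring.join G (⊤ : SimpleGraph (Fin t))) := by
  classical
  cases nonempty_fintype V
  rw [OnlineListColoring.sum_numClasses hm, OnlineListColoring.numClasses_eq, ge_iff_le,
    sub_le_iff_le_add] at ht
  have ht : ∑ c, ((Finset.univ.filter fun v => C v = c).card - 1).choose 2 ≤
      t + (Finset.univ.filter fun c => (Finset.univ.filter fun v => C v = c).card = 1).card := by
    exact_mod_cast ht
  have hinl : ∀ c, (Finset.univ.filter fun v =>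
      OnlineListColoring.joinColoring C t v = Sum.inl c).card =
      (Finset.univ.filter fun v => C v = c).card := by
    intro c
    rw [Finset.card_filter, Finset.card_filter, Fintype.sum_sum_type]
    simp only [OnlineListColoring.joinColoring_inl, OnlineListColoring.joinColoring_inr,
      Sum.inl.injEq, reduceCtorEq, if_false, Finset.sum_const_zero, add_zero]
  have hinr : ∀ i, (Finset.univ.filter fun v =>
      OnlineListColoring.joinColoring C t v = Sum.inr i).card = 1 := by
    intro i
    rw [Finset.card_filter, Fintype.sum_sum_type]
    simp
  -- The `t` vertices of `K_t` are new singleton classes, which turns `ht` into the hypothesis of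
  -- `onlineChoosable_of_coloring`.
  have hch : OnlineListColoring.OnlineChoosable
      (OnlineListColoring.join G (⊤ : SimpleGraph (Fin t))) (n + t) := by
    have h := OnlineListColoring.onlineChoosable_of_coloring
      (OnlineListColoring.joinColoring C t) ?_
    · simpa using h
    · rw [Finset.card_filter, Fintype.sum_sum_type, Fintype.sum_sum_type]
      simp only [hinl, hinr]
      rw [← Finset.card_filter]
      simpa [add_comm] using ht
  exact le_antisymm
    (hch.onlineChoiceNumber_le.trans (OnlineListColoring.add_le_chromaticNumber_join t hn))
    (OnlineListColoring.chromaticNumber_le_onlineChoiceNumber _)
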